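/- Let $\Bbbk$ be an algebraically closed field of characteristic zero, and let $\mathbb{H}_4=\Bbbk\langle g,x \mid g^2=1,\ x^2=0,\ xg=-gx\rangle$ be Sweedler's Hopf algebra, with $\Delta(g)=g\otimes g$ and $\Delta(x)=x\otimes 1+g\otimes x$. A partial action of a bialgebra $H$ on a unital associative $\Bbbk$-algebra $R$ is a linear map $\cdot: H\otimes R\to R$ such that, for all $h,l\in H$ and $r,s\in R$, $$1_H\cdot r=r,\qquad h\cdot(rs)=(h_1\cdot r)(h_2\cdot s),\qquad h\cdot(l\cdot r)=(h_1\cdot 1_R)(h_2l\cdot r);$$ it is symmetric if moreover $h\cdot(l\cdot r)=(h_1l\cdot r)(h_2\cdot 1_R)$. Let $\mathbb{H}_4[y,\sigma]$ be a Hopf--Ore extension of $\mathbb{H}_4$ with $\Delta(y)=y\otimes 1+g\otimes y$. That is, $\sigma$ is an automorphism of $\mathbb{H}_4$ for which there is a character $\chi:\mathbb{H}_4\to\Bbbk$ with $\sigma(a)=\chi(a_1)a_2=ga_1g^{-1}\chi(a_2)$ for all $a\in\mathbb{H}_4$; the algebra $\mathbb{H}_4[y,\sigma]$ is generated by $\mathbb{H}_4$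 and $y$ with $ya=\sigma(a)y$, and each of its elements is uniquely of the form $\sum_i a_iy^i$ with $a_i\in\mathbb{H}_4$; its coproduct extends that of $\mathbb{H}_4$. Put $q=\chi(g)$. Let $\cdot:\mathbb{H}_4\otimes R\to R$ be a partial action with $g\cdot 1_R=0$, let $w\in R$, and put $\Omega=x\cdot 1_R$. Extend $\cdot$ to the linear map $\mathbb{H}_4[y,\sigma]\otimes R\to R$ given by $$y^ja\cdot r=\sum_{k=0}^{j}(-1)^kq^{-\frac{k(k-1)}{2}}\binom{j}{k}_{q^{-1}}w^{j-k}(g^ka\cdot r)w^k\qquad(j\ge 0,\ a\in\mathbb{H}_4,\ r\in R),$$ where the $p$-binomial coefficients are defined by $\binom{n}{0}_p=1$, $\binom{0}{m}_p=0$ for $m\ge1$, and $\binom{n}{m}_p=\binom{n-1}{m}_p+p^{\,n-m}\binom{n-1}{m-1}_p$ for $1\le m\le n$ (and $\binom{n}{m}_p=0$ for $m>n$). Then $y\cdot 1_R=w$, and this map is a symmetric partial action of $\mathbb{H}_4[y,\sigma]$ on $R$ if and only if $w\Omega+\Omega w$ lies in the center $Z(R)$. -/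

import Mathlib

open scoped TensorProduct

/-- Sweedler's Hopf algebra `H₄ = k⟨g, x | g² = 1, x² = 0, xg = -gx⟩`. As an algebra it is the
(degenerate) quaternion algebra with `i² = 1`, `j² = 0`, `ij = k = -ji`, where `g = i` and
`x = j`; its basis is `1, g, x, gx`, and `Sweedler.lift` and `Sweedler.algHom_ext` are the universal
property of the presentation. -/
abbrev Sweedler (k : Type*) [Field k] : Type _ := QuaternionAlgebra k 1 0 0

namespace Sweedler

variable (k : Type*) [Field k]

/-- The generator `g`. -/
def g : Sweedler k := ⟨0, 1, 0, 0⟩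
/-- The generator `x`. -/
def x : Sweedler k := ⟨0, 0, 1, 0⟩

lemma g_mul_g : g k * g k = 1 := by ext <;> simp [g]
lemma x_mul_x : x k * x k = 0 := by ext <;> simp [x]
lemma x_mul_g : x k * g k = -(g k * x k) := by ext <;> simp [g, x]

variable {k}

lemma eq_sum (a : Sweedler k) :
    a = a.re • 1 + a.imI • g k + a.imJ • x k + a.imK • (g k * x k) := by
  ext <;> simp [g, x]

/-- The universal property of the presentation. -/
def lift {B : Type*} [Ring B] [Algebra k B] (G X : B)
    (hG : G * G = 1) (hX : X * X = 0) (hXG : X * G = -(G * X)) : Sweedler k →ₐ[k] B :=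
  QuaternionAlgebra.lift
    { i := G, j := X, k := G * X, i_mul_i := by simp [hG], j_mul_j := by simp [hX],
      i_mul_j := rfl, j_mul_i := by simp [hXG] }

section
variable {B : Type*} [Ring B] [Algebra k B] {G X : B}
    {hG : G * G = 1} {hX : X * X = 0} {hXG : X * G = -(G * X)}

lemma lift_g : lift G X hG hX hXG (g k) = G := by
  simp [lift, g, QuaternionAlgebra.Basis.lift]

lemma lift_x : lift G X hG hX hXG (x k) = X := by
  simp [lift, x, QuaternionAlgebra.Basis.lift]

lemma algHom_ext {f f' : Sweedler k →ₐ[k] B} (hg : f (g k) = f' (g k))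
    (hx : f (x k) = f' (x k)) : f = f' :=
  QuaternionAlgebra.hom_ext hg hx
end

lemma linearMap_ext {M : Type*} [AddCommGroup M] [Module k M] {f f' : Sweedler k →ₗ[k] M}
    (h1 : f 1 = f' 1) (hg : f (g k) = f' (g k)) (hx : f (x k) = f' (x k))
    (hgx : f (g k * x k) = f' (g k * x k)) : f = f' := by
  ext a
  rw [eq_sum a]
  simp [h1, hg, hx, hgx]

variable (k) in
/-- The comultiplication, as an algebra homomorphism. -/
noncomputable def comulHom : Sweedler k →ₐ[k] Sweedler k ⊗[k] Sweedler k :=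
  lift (g k ⊗ₜ[k] g k) (x k ⊗ₜ[k] 1 + g k ⊗ₜ[k] x k)
    (by simp [g_mul_g, Algebra.TensorProduct.one_def])
    (by simp [mul_add, add_mul, x_mul_x, x_mul_g, TensorProduct.neg_tmul])
    (by simp [mul_add, add_mul, x_mul_g, g_mul_g, TensorProduct.neg_tmul,
          TensorProduct.tmul_neg]; abel)

variable (k) in
/-- The counit, as an algebra homomorphism. -/
noncomputable def counitHom : Sweedler k →ₐ[k] k := lift 1 0 (by simp) (by simp) (by simp)

@[simp] lemma comulHom_g : comulHom k (g k) = g k ⊗ₜ[k] g k := lift_g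
@[simp] lemma comulHom_x : comulHom k (x k) = x k ⊗ₜ[k] 1 + g k ⊗ₜ[k] x k := lift_x
@[simp] lemma counitHom_g : counitHom k (g k) = 1 := lift_g
@[simp] lemma counitHom_x : counitHom k (x k) = 0 := lift_x

/-- `Δ(g) = g ⊗ g`, `Δ(x) = x ⊗ 1 + g ⊗ x`, `ε(g) = 1`, `ε(x) = 0`. -/
noncomputable instance : Bialgebra k (Sweedler k) :=
  Bialgebra.ofAlgHom (comulHom k) (counitHom k)
    (algHom_ext (by simp)
      (by simp [TensorProduct.add_tmul, TensorProduct.tmul_add,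
            Algebra.TensorProduct.one_def, add_assoc]))
    (algHom_ext (by simp) (by simp))
    (algHom_ext (by simp) (by simp))

lemma comul_g : Coalgebra.comul (R := k) (g k) = g k ⊗ₜ[k] g k := comulHom_g
lemma comul_x : Coalgebra.comul (R := k) (x k) = x k ⊗ₜ[k] 1 + g k ⊗ₜ[k] x k := comulHom_x
lemma counit_g : Coalgebra.counit (R := k) (g k) = 1 := counitHom_g
lemma counit_x : Coalgebra.counit (R := k) (x k) = 0 := counitHom_x

lemma comul_gx : Coalgebra.comul (R := k) (g k * x k)
    = (g k * x k) ⊗ₜ[k] g k + 1 ⊗ₜ[k] (g k * x k) := by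
  simp [comul_g, comul_x, mul_add, g_mul_g]

/-- The antipode is determined by `S(1) = 1`, `S(g) = g`, `S(x) = -gx`, `S(gx) = x`. -/
noncomputable instance : HopfAlgebra k (Sweedler k) where
  antipode :=
    { toFun := fun a => ⟨a.re, a.imI, a.imK, -a.imJ⟩
      map_add' := fun a b => by ext <;> simp [add_comm]
      map_smul' := fun c a => by ext <;> simp }
  mul_antipode_rTensor_comul := by
    apply linearMap_ext
    · simp [Algebra.TensorProduct.one_def]; ext <;> simp
    · simp [comul_g, counit_g]; ext <;> simp [g]
    · simp [comul_x, counit_x]; ext <;> simp [g, x]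
    · rw [LinearMap.comp_apply, LinearMap.comp_apply, comul_gx]
      simp [counit_x]; ext <;> simp [g, x]
  mul_antipode_lTensor_comul := by
    apply linearMap_ext
    · simp [Algebra.TensorProduct.one_def]; ext <;> simp
    · simp [comul_g, counit_g]; ext <;> simp [g]
    · simp [comul_x, counit_x]; ext <;> simp [g, x]
    · rw [LinearMap.comp_apply, LinearMap.comp_apply, comul_gx]
      simp [counit_x]; ext <;> simp [g, x]

lemma isGroupLikeElem_g : IsGroupLikeElem k (g k) := ⟨counit_g, comul_g⟩

end Sweedler

section Ore
variable {k A : Type*} [Field k] [Ring A] [Algebra k A]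

/-- A copy of `A` on which the monoid `ℕ` acts through the powers of `σ`. -/
def OreCoeff (_σ : A ≃ₐ[k] A) : Type _ := A

namespace OreCoeff
variable (σ : A ≃ₐ[k] A)

instance : Ring (OreCoeff σ) := inferInstanceAs (Ring A)
instance : Algebra k (OreCoeff σ) := inferInstanceAs (Algebra k A)

/-- The identity map from `A` to its copy. -/
def of : A ≃ₐ[k] OreCoeff σ := AlgEquiv.refl

noncomputable instance : MulSemiringAction (Multiplicative ℕ) (OreCoeff σ) :=
  MulSemiringAction.compHom (OreCoeff σ)
    (powersHom (OreCoeff σ ≃ₐ[k] OreCoeff σ) (((of σ).symm.trans σ).trans (of σ)))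

lemma ofAdd_one_smul (a : A) :
    (Multiplicative.ofAdd 1 : Multiplicative ℕ) • of σ a = of σ (σ a) := by
  change ((((of σ).symm.trans σ).trans (of σ)) ^ 1) (of σ a) = _
  simp

instance : SMulCommClass (Multiplicative ℕ) k (OreCoeff σ) :=
  ⟨fun n c a => map_smul ((((of σ).symm.trans σ).trans (of σ)) ^ n.toAdd) c a⟩

end OreCoeff

/-- The Ore extension `A[y, σ]`, the free left `A`-module on `1, y, y², …` with the product
determined by `y a = σ(a) y`. -/
abbrev OreExtension (σ : A ≃ₐ[k] A) : Type _ := SkewPolynomial (OreCoeff σ)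

namespace OreExtension
open Multiplicative SkewMonoidAlgebra
variable (σ : A ≃ₐ[k] A)

/-- The inclusion of `A` in `A[y, σ]`. -/
noncomputable def C : A →ₐ[k] OreExtension σ :=
  { (SkewMonoidAlgebra.singleOneRingHom :
      OreCoeff σ →+* SkewMonoidAlgebra (OreCoeff σ) (Multiplicative ℕ)).comp
        (OreCoeff.of σ : A →+* OreCoeff σ) with
    commutes' := fun _ => rfl }

/-- The variable `y` of `A[y, σ]`. -/
noncomputable def y : OreExtension σ := SkewPolynomial.X

lemma C_apply (a : A) : C σ a = single 1 (OreCoeff.of σ a) := rfl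
lemma y_def : y σ = single (ofAdd 1) 1 := rfl

lemma y_mul_C (a : A) : y σ * C σ a = C σ (σ a) * y σ := by
  simp [C_apply, y_def, single_mul_single, OreCoeff.ofAdd_one_smul]

lemma y_pow (n : ℕ) : y σ ^ n = single (ofAdd n) 1 :=
  (SkewPolynomial.monomial_one_right_eq_X_pow n).symm

lemma y_pow_mul_C (n : ℕ) (a : A) : y σ ^ n * C σ a = C σ ((σ ^ n) a) * y σ ^ n := by
  induction n generalizing a with
  | zero => simp
  | succ n ih => rw [pow_succ, mul_assoc, y_mul_C, ← mul_assoc, ih, pow_succ, mul_assoc]; rfl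

lemma single_eq (n : ℕ) (a : A) :
    (single (ofAdd n) (OreCoeff.of σ a) : OreExtension σ) = C σ a * y σ ^ n := by
  rw [y_pow, C_apply, single_mul_single]
  simp

/-- Left coefficients: `∑ aₙ yⁿ` is sent to `(aₙ)`. -/
noncomputable def coeffEquiv : OreExtension σ ≃ₗ[k] (ℕ →₀ A) :=
  (coeffLinearEquiv (k := OreCoeff σ) (G := Multiplicative ℕ) (S := k)).trans
    ((Finsupp.domLCongr Multiplicative.toAdd).trans
      (Finsupp.mapRange.linearEquiv (OreCoeff.of σ).symm.toLinearEquiv))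

lemma coeffEquiv_C_mul_y_pow (a : A) (n : ℕ) :
    coeffEquiv σ (C σ a * y σ ^ n) = Finsupp.single n a := by
  rw [← single_eq]
  change Finsupp.mapRange (OreCoeff.of σ).symm (map_zero _)
    (Finsupp.equivMapDomain toAdd (Finsupp.single (ofAdd n) (OreCoeff.of σ a))) = _
  simp

lemma linearMap_ext {M : Type*} [AddCommGroup M] [Module k M] {f f' : OreExtension σ →ₗ[k] M}
    (h : ∀ a n, f (C σ a * y σ ^ n) = f' (C σ a * y σ ^ n)) : f = f' := by
  refine lhom_ext fun n a => ?_
  obtain ⟨n, rfl⟩ := ofAdd.surjective n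
  obtain ⟨a, rfl⟩ := (OreCoeff.of σ).surjective a
  rw [single_eq]
  exact h a n

variable {σ}
/-- The universal property of `A[y, σ]`. -/
noncomputable def lift {B : Type*} [Ring B] [Algebra k B] (f : A →ₐ[k] B) (b : B)
    (h : ∀ a, b * f a = f (σ a) * b) : OreExtension σ →ₐ[k] B :=
  liftNCAlgHom (f.comp (OreCoeff.of σ).symm.toAlgHom) (powersHom B b) (by
    intro a n
    obtain ⟨n, rfl⟩ := ofAdd.surjective n
    obtain ⟨a, rfl⟩ := (OreCoeff.of σ).surjective a
    simp only [powersHom_apply, toAdd_ofAdd]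
    induction n generalizing a with
    | zero => simp
    | succ n ih =>
      rw [ofAdd_add, mul_smul, OreCoeff.ofAdd_one_smul, pow_succ, ← mul_assoc, ih, mul_assoc]
      simp [h, mul_assoc])

section
variable {B : Type*} [Ring B] [Algebra k B] {f : A →ₐ[k] B} {b : B}
  {h : ∀ a, b * f a = f (σ a) * b}

@[simp] lemma lift_C (a : A) : lift f b h (C σ a) = f a := by
  simp [lift, C_apply, liftNCAlgHom, liftNCRingHom]

@[simp] lemma lift_y : lift f b h (y σ) = b := by
  simp [lift, y_def, liftNCAlgHom, liftNCRingHom]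

lemma algHom_ext {f f' : OreExtension σ →ₐ[k] B} (hC : ∀ a, f (C σ a) = f' (C σ a))
    (hy : f (y σ) = f' (y σ)) : f = f' :=
  AlgHom.toLinearMap_injective <| linearMap_ext σ fun a n => by simp [hC, hy]
end

end OreExtension
end Ore

section HopfOre
open Coalgebra HopfAlgebra
variable (k : Type*) {A : Type*} [Field k] [Ring A] [HopfAlgebra k A]

/-- The data of a Hopf–Ore extension `A[y, σ]` of a Hopf algebra `A` with
`Δ(y) = y ⊗ 1 + g ⊗ y`: a group-like element `g`, an automorphism `σ` and a character `χ` with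
`σ(a) = χ(a₁) a₂ = g a₁ g⁻¹ χ(a₂)`. -/
structure HopfOreData (g : A) where
  isGroupLikeElem : IsGroupLikeElem k g
  σ : A ≃ₐ[k] A
  χ : A →ₐ[k] k
  σ_eq_left : ∀ a, σ a = TensorProduct.lid k A (χ.toLinearMap.rTensor A (comul a))
  σ_eq_right : ∀ a, σ a =
    g * TensorProduct.rid k A (χ.toLinearMap.lTensor A (comul a)) * antipode k g

namespace HopfOreData
variable {k} {g : A} (D : HopfOreData k g)

lemma comul_σ_left (a : A) :
    comul (R := k) (D.σ a) = D.σ.toLinearMap.rTensor A (comul a) := by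
  have key : ∀ t : A ⊗[k] A,
      comul (R := k) (TensorProduct.lid k A (D.χ.toLinearMap.rTensor A t)) =
        ((TensorProduct.lid k A).toLinearMap ∘ₗ D.χ.toLinearMap.rTensor A).rTensor A
          ((TensorProduct.assoc k A A A).symm (comul.lTensor A t)) := by
    intro t
    induction t with
    | zero => simp
    | add s t hs ht => simp only [map_add, hs, ht]
    | tmul a b =>
      simp only [LinearMap.rTensor_tmul, LinearMap.lTensor_tmul, TensorProduct.lid_tmul, map_smul]
      generalize comul (R := k) b = t
      induction t with
      | zero => simp
      | add s t hs ht => simp only [map_add, TensorProduct.tmul_add, smul_add, hs, ht]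
      | tmul c d => simp [TensorProduct.smul_tmul']
  have hσ : D.σ.toLinearMap = ((TensorProduct.lid k A).toLinearMap ∘ₗ
      D.χ.toLinearMap.rTensor A) ∘ₗ comul :=
    LinearMap.ext D.σ_eq_left
  rw [D.σ_eq_left, key, coassoc_symm_apply, hσ]
  exact (LinearMap.rTensor_comp_apply _ _ _ _).symm

lemma comul_σ_right (a : A) :
    comul (R := k) (D.σ a) * (g ⊗ₜ 1) = (g ⊗ₜ 1) * D.σ.toLinearMap.lTensor A (comul a) := by
  set ρ : A ⊗[k] A →ₗ[k] A :=
    (TensorProduct.rid k A).toLinearMap ∘ₗ D.χ.toLinearMap.lTensor A with hρ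
  have key : ∀ t : A ⊗[k] A, comul (R := k) (ρ t) =
        ρ.lTensor A (TensorProduct.assoc k A A A (comul.rTensor A t)) := by
    intro t
    induction t with
    | zero => simp
    | add s t hs ht => simp only [map_add, hs, ht]
    | tmul a b =>
      simp only [hρ, LinearMap.rTensor_tmul, LinearMap.lTensor_tmul, TensorProduct.rid_tmul,
        map_smul, LinearMap.comp_apply, LinearEquiv.coe_coe]
      generalize comul (R := k) a = t
      induction t with
      | zero => simp
      | add s t hs ht => simp only [map_add, TensorProduct.add_tmul, smul_add, hs, ht]
      | tmul c d => simp
  have hσ : ∀ a, D.σ a = g * ρ (comul a) * antipode k g := D.σ_eq_right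
  have hg := D.isGroupLikeElem
  have h2 : ∀ t : A ⊗[k] A, (g ⊗ₜ[k] g) * ρ.lTensor A (comul.lTensor A t) *
      (antipode k g ⊗ₜ[k] antipode k g) * (g ⊗ₜ 1) =
        (g ⊗ₜ 1) * D.σ.toLinearMap.lTensor A t := by
    intro t
    induction t with
    | zero => simp
    | add s t hs ht => simp only [map_add, mul_add, add_mul, hs, ht]
    | tmul a b => simp [hσ, mul_assoc, hg.antipode_mul_cancel]
  rw [hσ, Bialgebra.comul_mul, Bialgebra.comul_mul, hg.comul_eq_tmul_self,
    hg.antipode.comul_eq_tmul_self, key, coassoc_apply, h2]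

/-- The Hopf–Ore extension `A[y, σ]`. -/
abbrev Ext : Type _ := OreExtension D.σ

/-- The comultiplication: it extends that of `A`, and `Δ(y) = y ⊗ 1 + g ⊗ y`. -/
noncomputable def comulHom : D.Ext →ₐ[k] D.Ext ⊗[k] D.Ext :=
  OreExtension.lift
    ((Algebra.TensorProduct.map (OreExtension.C D.σ) (OreExtension.C D.σ)).comp
      (Bialgebra.comulAlgHom k A))
    (OreExtension.y D.σ ⊗ₜ[k] 1 + OreExtension.C D.σ g ⊗ₜ[k] OreExtension.y D.σ) (by
    intro a
    set m := Algebra.TensorProduct.map (OreExtension.C D.σ) (OreExtension.C D.σ)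
    set y := OreExtension.y D.σ
    have h1 : ∀ t : A ⊗[k] A,
        (y ⊗ₜ[k] 1) * m t = m (D.σ.toLinearMap.rTensor A t) * (y ⊗ₜ[k] 1) := by
      intro t
      induction t with
      | zero => simp
      | add s t hs ht => simp only [map_add, mul_add, add_mul, hs, ht]
      | tmul a b => simp [m, y, OreExtension.y_mul_C]
    have h2 : ∀ t : A ⊗[k] A,
        (1 ⊗ₜ[k] y) * m t = m (D.σ.toLinearMap.lTensor A t) * (1 ⊗ₜ[k] y) := by
      intro t
      induction t with
      | zero => simp
      | add s t hs ht => simp only [map_add, mul_add, add_mul, hs, ht]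
      | tmul a b => simp [m, y, OreExtension.y_mul_C]
    have h3 : OreExtension.C D.σ g ⊗ₜ[k] y = m (g ⊗ₜ 1) * (1 ⊗ₜ[k] y) := by simp [m]
    simp only [AlgHom.comp_apply, Bialgebra.comulAlgHom_apply]
    rw [h3, add_mul, mul_add, h1, ← D.comul_σ_left, mul_assoc, h2, ← mul_assoc, ← map_mul,
      ← D.comul_σ_right, map_mul, mul_assoc])

/-- The counit: it extends that of `A`, and `ε(y) = 0`. -/
noncomputable def counitHom : D.Ext →ₐ[k] k :=
  OreExtension.lift (Bialgebra.counitAlgHom k A) 0 (by simp)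

@[simp] lemma comulHom_C (a : A) : D.comulHom (OreExtension.C D.σ a) =
    Algebra.TensorProduct.map (OreExtension.C D.σ) (OreExtension.C D.σ) (comul a) :=
  OreExtension.lift_C a

@[simp] lemma comulHom_y : D.comulHom (OreExtension.y D.σ) =
    OreExtension.y D.σ ⊗ₜ[k] 1 + OreExtension.C D.σ g ⊗ₜ[k] OreExtension.y D.σ :=
  OreExtension.lift_y

@[simp] lemma counitHom_C (a : A) : D.counitHom (OreExtension.C D.σ a) = counit a :=
  OreExtension.lift_C a

@[simp] lemma counitHom_y : D.counitHom (OreExtension.y D.σ) = 0 :=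
  OreExtension.lift_y

noncomputable instance : Bialgebra k D.Ext :=
  Bialgebra.ofAlgHom D.comulHom D.counitHom
    (OreExtension.algHom_ext
      (fun a => by
        have h : ∀ t : A ⊗[k] A, Algebra.TensorProduct.assoc k k k D.Ext D.Ext D.Ext
            (Algebra.TensorProduct.map D.comulHom (AlgHom.id k D.Ext)
              (Algebra.TensorProduct.map (OreExtension.C D.σ) (OreExtension.C D.σ) t)) =
            Algebra.TensorProduct.map (OreExtension.C D.σ)
              (Algebra.TensorProduct.map (OreExtension.C D.σ) (OreExtension.C D.σ))
              (TensorProduct.assoc k A A A (comul.rTensor A t)) := by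
          intro t
          induction t with
          | zero => simp
          | add s t hs ht => simp only [map_add, hs, ht]
          | tmul a b =>
            simp only [Algebra.TensorProduct.map_tmul, comulHom_C, LinearMap.rTensor_tmul]
            generalize comul (R := k) a = t
            induction t with
            | zero => simp
            | add s t hs ht => simp only [map_add, TensorProduct.add_tmul, hs, ht]
            | tmul c d => simp
        have h' : ∀ t : A ⊗[k] A,
            Algebra.TensorProduct.map (AlgHom.id k D.Ext) D.comulHom
              (Algebra.TensorProduct.map (OreExtension.C D.σ) (OreExtension.C D.σ) t) =
            Algebra.TensorProduct.map (OreExtension.C D.σ)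
              (Algebra.TensorProduct.map (OreExtension.C D.σ) (OreExtension.C D.σ))
              (comul.lTensor A t) := by
          intro t
          induction t with
          | zero => simp
          | add s t hs ht => simp only [map_add, hs, ht]
          | tmul a b => simp
        simp only [AlgHom.comp_apply, comulHom_C, h', ← coassoc_apply]
        exact h _)
      (by
        simp [D.isGroupLikeElem.comul_eq_tmul_self, TensorProduct.add_tmul,
          TensorProduct.tmul_add, Algebra.TensorProduct.one_def, add_assoc]))
    (OreExtension.algHom_ext
      (fun a => by
        have h : ∀ t : A ⊗[k] A, Algebra.TensorProduct.map D.counitHom (AlgHom.id k D.Ext)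
            (Algebra.TensorProduct.map (OreExtension.C D.σ) (OreExtension.C D.σ) t) =
            Algebra.TensorProduct.map (AlgHom.id k k) (OreExtension.C D.σ)
              (counit.rTensor A t) := by
          intro t
          induction t with
          | zero => simp
          | add s t hs ht => simp only [map_add, hs, ht]
          | tmul a b => simp
        simp [h])
      (by simp [D.isGroupLikeElem.counit_eq_one]))
    (OreExtension.algHom_ext
      (fun a => by
        have h : ∀ t : A ⊗[k] A, Algebra.TensorProduct.map (AlgHom.id k D.Ext) D.counitHom
            (Algebra.TensorProduct.map (OreExtension.C D.σ) (OreExtension.C D.σ) t) =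
            Algebra.TensorProduct.map (OreExtension.C D.σ) (AlgHom.id k k)
              (counit.lTensor A t) := by
          intro t
          induction t with
          | zero => simp
          | add s t hs ht => simp only [map_add, hs, ht]
          | tmul a b => simp
        simp [h])
      (by simp))

lemma comul_C (a : A) : comul (R := k) (OreExtension.C D.σ a : D.Ext) =
    Algebra.TensorProduct.map (OreExtension.C D.σ) (OreExtension.C D.σ) (comul (R := k) a) :=
  D.comulHom_C a

lemma comul_y : comul (R := k) (OreExtension.y D.σ : D.Ext) =
    OreExtension.y D.σ ⊗ₜ[k] 1 + OreExtension.C D.σ g ⊗ₜ[k] OreExtension.y D.σ :=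
  D.comulHom_y

end HopfOreData
end HopfOre

namespace Sweedler
open Coalgebra HopfAlgebra
variable (k : Type*) [Field k]

/-- The endomorphism of `H₄` with `g ↦ -g` and `x ↦ -x`. -/
noncomputable def negHom : Sweedler k →ₐ[k] Sweedler k :=
  lift (-g k) (-x k) (by simp [g_mul_g]) (by simp [x_mul_x]) (by simp [x_mul_g])

@[simp] lemma negHom_g : negHom k (g k) = -g k := lift_g
@[simp] lemma negHom_x : negHom k (x k) = -x k := lift_x

/-- The automorphism of `H₄` with `g ↦ -g` and `x ↦ -x`. -/
noncomputable def negAut : Sweedler k ≃ₐ[k] Sweedler k :=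
  AlgEquiv.ofAlgHom (negHom k) (negHom k) (algHom_ext (by simp) (by simp))
    (algHom_ext (by simp) (by simp))

@[simp] lemma negAut_g : negAut k (g k) = -g k := negHom_g k
@[simp] lemma negAut_x : negAut k (x k) = -x k := negHom_x k

/-- The data of the Hopf–Ore extension `H₄[y, σ]` with `σ(g) = -g`, `σ(x) = -x`. -/
noncomputable def hopfOreData : HopfOreData k (g k) where
  isGroupLikeElem := isGroupLikeElem_g
  σ := negAut k
  χ := lift (-1) 0 (by simp) (by simp) (by simp)
  σ_eq_left a := by
    refine LinearMap.congr_fun (f := (negAut k).toLinearMap)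
      (g := (TensorProduct.lid k _).toLinearMap ∘ₗ LinearMap.rTensor _ _ ∘ₗ comul)
      (linearMap_ext ?_ ?_ ?_ ?_) a
    · simp [Algebra.TensorProduct.one_def]
    · simp [comul_g, lift_g]
    · simp [comul_x, lift_g, lift_x]
    · rw [LinearMap.comp_apply, LinearMap.comp_apply, comul_gx]
      simp [lift_x]
  σ_eq_right a := by
    have hS : antipode k (g k) = g k := by
      have h := isGroupLikeElem_g (k := k).antipode_mul_cancel
      calc antipode k (g k) = antipode k (g k) * (g k * g k) := by rw [g_mul_g, mul_one]
        _ = g k := by rw [← mul_assoc, h, one_mul]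
    rw [hS]
    refine LinearMap.congr_fun (f := (negAut k).toLinearMap)
      (g := LinearMap.mulRight k (g k) ∘ₗ LinearMap.mulLeft k (g k) ∘ₗ
        (TensorProduct.rid k _).toLinearMap ∘ₗ LinearMap.lTensor _ _ ∘ₗ comul)
      (linearMap_ext ?_ ?_ ?_ ?_) a
    · simp [Algebra.TensorProduct.one_def, g_mul_g]
    · simp [comul_g, lift_g, g_mul_g]
    · simp [comul_x, lift_x]; ext <;> simp [g, x]
    · rw [LinearMap.comp_apply, LinearMap.comp_apply, LinearMap.comp_apply, LinearMap.comp_apply,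
        comul_gx]
      simp [lift_g, lift_x]; ext <;> simp [g, x]

end Sweedler

section PartialAction
open Coalgebra
variable {k H R : Type*} [Field k] [Ring H] [Bialgebra k H] [Ring R] [Algebra k R]

/-- A (left) partial action of `H` on `R`, where `act h r` is `h · r`:
`1 · r = r`, `h · (r s) = (h₁ · r)(h₂ · s)` and `h · (l · r) = (h₁ · 1)(h₂ l · r)`. -/
structure IsPartialAction (act : H →ₗ[k] R →ₗ[k] R) : Prop where
  one_act : ∀ r, act 1 r = r
  act_mul : ∀ h r s, act h (r * s) =
    LinearMap.mul' k R (TensorProduct.map (act.flip r) (act.flip s) (comul h))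
  act_act : ∀ h l r, act h (act l r) =
    LinearMap.mul' k R (TensorProduct.map (act.flip 1)
      (act.flip r ∘ₗ LinearMap.mulRight k l) (comul h))

/-- A partial action is symmetric if also `h · (l · r) = (h₁ l · r)(h₂ · 1)`. -/
structure IsSymmetricPartialAction (act : H →ₗ[k] R →ₗ[k] R) : Prop
    extends IsPartialAction act where
  act_act_symm : ∀ h l r, act h (act l r) =
    LinearMap.mul' k R (TensorProduct.map (act.flip r ∘ₗ LinearMap.mulRight k l)
      (act.flip 1) (comul h))

end PartialAction

/-- The `q`-binomial coefficient `(n choose m)_q`, given by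
`(n choose m)_q = (n-1 choose m)_q + q^(n-m) (n-1 choose m-1)_q`. -/
def qBinom {k : Type*} [Field k] (q : k) : ℕ → ℕ → k
  | _, 0 => 1
  | 0, _ + 1 => 0
  | n + 1, m + 1 => qBinom q n (m + 1) + q ^ (n - m) * qBinom q n m

section Extension
variable {k A R : Type*} [Field k] [Ring A] [HopfAlgebra k A] [Ring R] [Algebra k R]
  {g : A} (D : HopfOreData k g) (act : A →ₗ[k] R →ₗ[k] R) (w : R)

namespace HopfOreData

/-- The map sending `a` and `r` to
`∑_{i=0}^{j} (-1)^i q^{-i(i-1)/2} (j choose i)_{q⁻¹} w^{j-i} (gⁱ a · r) wⁱ` with `q = χ(g)`. -/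
noncomputable def extendTerm (j : ℕ) : A →ₗ[k] R →ₗ[k] R :=
  LinearMap.mk₂ k
    (fun a r => ∑ i ∈ Finset.range (j + 1),
      ((-1) ^ i * (D.χ g)⁻¹ ^ (i * (i - 1) / 2) * qBinom (D.χ g)⁻¹ j i) •
        (w ^ (j - i) * act (g ^ i * a) r * w ^ i))
    (by simp [mul_add, add_mul, Finset.sum_add_distrib])
    (by
      intro c a r
      simp only [Finset.smul_sum, mul_smul_comm, map_smul, LinearMap.smul_apply, smul_mul_assoc]
      exact Finset.sum_congr rfl fun _ _ => smul_comm _ _ _)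
    (by simp [mul_add, add_mul, Finset.sum_add_distrib])
    (by
      intro c a r
      simp only [Finset.smul_sum, mul_smul_comm, map_smul, smul_mul_assoc]
      exact Finset.sum_congr rfl fun _ _ => smul_comm _ _ _)

/-- The extension to `A[y, σ]` of `act`, determined by the formula
`yʲ a · r = ∑_{i=0}^{j} (-1)^i q^{-i(i-1)/2} (j choose i)_{q⁻¹} w^{j-i} (gⁱ a · r) wⁱ`. The left
coefficient of `yʲ a` is `σʲ(a)`. -/
noncomputable def extend : D.Ext →ₗ[k] R →ₗ[k] R :=
  Finsupp.lsum k (fun j => D.extendTerm act w j ∘ₗ (D.σ ^ j).symm.toLinearMap) ∘ₗ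
    (OreExtension.coeffEquiv D.σ).toLinearMap

lemma extend_apply (j : ℕ) (a : A) (r : R) :
    D.extend act w (OreExtension.y D.σ ^ j * OreExtension.C D.σ a) r =
      ∑ i ∈ Finset.range (j + 1),
        ((-1) ^ i * (D.χ g)⁻¹ ^ (i * (i - 1) / 2) * qBinom (D.χ g)⁻¹ j i) •
          (w ^ (j - i) * act (g ^ i * a) r * w ^ i) := by
  rw [OreExtension.y_pow_mul_C]
  simp [extend, OreExtension.coeffEquiv_C_mul_y_pow, extendTerm, -AlgEquiv.coe_pow]

end HopfOreData
end Extension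

/-! Since `g · 1 = 0`, the partial axioms leave no freedom in the action of `H₄`: `g` acts as zero,
`x` as left and `gx` as right multiplication by `Ω = x · 1`, and `Ω²` is central.

Such an action is the restriction to the first factor of a genuine module algebra `R × R`. There `g`
exchanges the factors and `x` acts by the inner skew derivation `b ↦ U b - b' U`, where `U = (Ω,
-Ω)` and `b'` is `b` with its components exchanged. The coproduct of `y` has the same shape as that
of `x`, so `y` should act by the skew derivation of `W = (w, -w)`. Both skew derivations anticommute
with the swap, and their anticommutator is the commutator with `UW + WU`. Comparing `σ(x)` with its
two formulas forces `q = -1` and `yx = -xy`, so the relations hold exactly when `wΩ + Ωw` is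
central. No relation involves `y²`, so nothing is asked of `w²`.

If `wΩ + Ωw` is central, restricting this module algebra gives a symmetric partial action
(`isSymmetricPartialAction_fstAct`, `moduleAlgebraSubalgebra_extRep`). It is the given map, because
both satisfy the same recursion in the power of `y` (`extend_y_pow_succ_mul_C`, `extend_eq_fstAct`).
Conversely, one instance of the composition axiom, at `gx` and `yg`, already yields centrality
(`mul_add_mul_comm_of_isPartialAction_extend`). -/

/-! ### Module algebras on a product and their restriction to one factor. -/

section Globalization
open Coalgebra
variable {k H B : Type*} [Field k] [Ring H] [Bialgebra k H] [Ring B] [Algebra k B]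

/-- The subalgebra of those `h` in a bialgebra acting on an algebra `B` that satisfy
`h · (b c) = (h₁ · b)(h₂ · c)` for all `b` and `c`. -/
def moduleAlgebraSubalgebra (ρ : H →ₐ[k] Module.End k B) : Subalgebra k H where
  carrier := {h | ∀ b c, ρ h (b * c) = LinearMap.mul' k B
    (TensorProduct.map (ρ.toLinearMap.flip b) (ρ.toLinearMap.flip c) (comul h))}
  mul_mem' := by
    intro h l hh hl b c
    have key : ∀ s t : H ⊗[k] H, (∀ b c, ρ h (b * c) = LinearMap.mul' k B
        (TensorProduct.map (ρ.toLinearMap.flip b) (ρ.toLinearMap.flip c) s)) →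
        ρ h (LinearMap.mul' k B
        (TensorProduct.map (ρ.toLinearMap.flip b) (ρ.toLinearMap.flip c) t)) =
        LinearMap.mul' k B
        (TensorProduct.map (ρ.toLinearMap.flip b) (ρ.toLinearMap.flip c) (s * t)) := by
      intro s t hs
      induction t with
      | zero => simp
      | add t t' ht ht' => simp only [map_add, mul_add, ht, ht']
      | tmul t t' =>
        simp only [TensorProduct.map_tmul, LinearMap.mul'_apply, hs]
        -- The rule `hs` concerns the whole tensor `s` and is not inherited by its summands, so it
        -- is used up before the induction on `s`.
        clear hs
        induction s with
        | zero => simp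
        | add s s' hs hs' => simp only [map_add, add_mul, hs, hs']
        | tmul s s' => simp
    rw [map_mul ρ, Module.End.mul_apply, hl, Bialgebra.comul_mul]
    exact key _ _ hh
  add_mem' := by
    intro h l hh hl b c
    simp only [map_add, LinearMap.add_apply]
    rw [hh, hl]
  algebraMap_mem' := by
    intro c a b
    simp [Algebra.TensorProduct.algebraMap_apply]

/-- The linear map `H ⊗ R → R` induced on the first factor of `R × S` by a representation
of `H` on `R × S`. -/
def fstAct {R S : Type*} [Ring R] [Algebra k R] [Ring S] [Algebra k S]
    (ρ : H →ₐ[k] Module.End k (R × S)) : H →ₗ[k] R →ₗ[k] R :=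
  LinearMap.mk₂ k (fun h r => (ρ h (r, 0)).1) (by simp) (by simp)
    (by
      intro h r s
      have : ((r + s, 0) : R × S) = (r, 0) + (s, 0) := by simp
      rw [this, map_add, Prod.fst_add])
    (by
      intro c h r
      have : ((c • r, 0) : R × S) = c • (r, 0) := by simp
      rw [this, map_smul, Prod.smul_fst])

/-- A module algebra structure on `R × S` induces a symmetric partial action on `R`. -/
lemma isSymmetricPartialAction_fstAct {R S : Type*} [Ring R] [Algebra k R] [Ring S] [Algebra k S]
    (ρ : H →ₐ[k] Module.End k (R × S)) (hρ : moduleAlgebraSubalgebra ρ = ⊤) :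
    IsSymmetricPartialAction (fstAct ρ) := by
  have hmul (h : H) (b c : R × S) : ρ h (b * c) = LinearMap.mul' k (R × S)
      (TensorProduct.map (ρ.toLinearMap.flip b) (ρ.toLinearMap.flip c) (comul h)) :=
    (hρ ▸ Algebra.mem_top : h ∈ moduleAlgebraSubalgebra ρ) b c
  have hact (h : H) (r : R) : fstAct ρ h r = (ρ h (r, 0)).1 := rfl
  refine ⟨⟨fun r => by simp [hact], fun h r s => ?_, fun h l r => ?_⟩, fun h l r => ?_⟩
  · have e : ((r * s, 0) : R × S) = (r, 0) * (s, 0) := by simp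
    rw [hact, e, hmul]
    generalize comul (R := k) h = t
    induction t with
    | zero => simp
    | add s t hs ht => simp only [map_add, Prod.fst_add, hs, ht]
    | tmul a b => simp [hact]
  -- Truncation to the first factor is multiplication by the central idempotent `(1, 0)`. Placing it
  -- on the left gives the ordinary axiom; placing it on the right gives the symmetric one.
  · have e : ((fstAct ρ l r, 0) : R × S) = (1, 0) * ρ l (r, 0) := by ext <;> simp [hact]
    rw [hact, e, hmul]
    generalize comul (R := k) h = t
    induction t with
    | zero => simp
    | add s t hs ht => simp only [map_add, Prod.fst_add, hs, ht]
    | tmul a b => simp [hact]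
  · have e : ((fstAct ρ l r, 0) : R × S) = ρ l (r, 0) * (1, 0) := by ext <;> simp [hact]
    rw [hact, e, hmul]
    generalize comul (R := k) h = t
    induction t with
    | zero => simp
    | add s t hs ht => simp only [map_add, Prod.fst_add, hs, ht]
    | tmul a b => simp [hact]

end Globalization

/-! ### Values forced on `χ`, on `σ` and on the action of `H₄`. -/

namespace Sweedler
open Coalgebra HopfAlgebra
variable {k : Type*} [Field k]

lemma gx_mul_g : g k * x k * g k = -x k := by
  rw [mul_assoc, x_mul_g, mul_neg, ← mul_assoc, g_mul_g, one_mul]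

lemma antipode_g : antipode k (g k) = g k := by
  rw [← mul_one (antipode k (g k)), ← g_mul_g, ← mul_assoc,
    isGroupLikeElem_g.antipode_mul_cancel, one_mul]

section HopfOre
variable (D : HopfOreData k (g k))

/-- At `x` the two formulas for `σ` read `χ(x) + χ(g) x` and `g (x + χ(x) g) g = -x + χ(x) g`. The
coefficients of `x` give `χ(g)`; those of `1` give `χ(x)` in the next lemma. -/
lemma χ_g : D.χ (g k) = -1 := by
  have h := (D.σ_eq_left (x k)).symm.trans (D.σ_eq_right (x k))
  simp only [comul_x, antipode_g] at h
  simpa [g, x] using congrArg QuaternionAlgebra.imJ h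

lemma χ_x : D.χ (x k) = 0 := by
  have h := (D.σ_eq_left (x k)).symm.trans (D.σ_eq_right (x k))
  simp only [comul_x, antipode_g] at h
  simpa [g, x] using congrArg QuaternionAlgebra.re h

lemma σ_g : D.σ (g k) = -g k := by
  rw [D.σ_eq_left, comul_g]
  simp [χ_g]

lemma σ_x : D.σ (x k) = -x k := by
  rw [D.σ_eq_left, comul_x]
  simp [χ_g, χ_x]

end HopfOre

section PartialAction
variable {R : Type*} [Ring R] [Algebra k R] {act : Sweedler k →ₗ[k] R →ₗ[k] R}

lemma act_g (hact : IsPartialAction act) (hg : act (g k) 1 = 0) (r : R) : act (g k) r = 0 := by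
  have := hact.act_mul (g k) 1 r
  simpa [comul_g, hg] using this

lemma act_x (hact : IsPartialAction act) (hg : act (g k) 1 = 0) (r : R) :
    act (x k) r = act (x k) 1 * r := by
  have := hact.act_mul (x k) 1 r
  simpa [comul_x, hg, hact.one_act] using this

/-- The composition axiom for `gx` and `g` has left side `gx · (g · 1) = 0`, while its right side
reduces to `gx · 1 - x · 1`. -/
lemma act_gx_one (hact : IsPartialAction act) (hg : act (g k) 1 = 0) :
    act (g k * x k) 1 = act (x k) 1 := by
  have := hact.act_act (g k * x k) (g k) 1
  rw [comul_gx] at this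
  simp [hg, hact.one_act, g_mul_g, gx_mul_g] at this
  exact (eq_of_sub_eq_zero (by rw [sub_eq_add_neg]; exact this.symm))

lemma act_gx (hact : IsPartialAction act) (hg : act (g k) 1 = 0) (r : R) :
    act (g k * x k) r = r * act (x k) 1 := by
  have := hact.act_mul (g k * x k) r 1
  rw [comul_gx] at this
  simpa [hg, hact.one_act, act_gx_one hact hg] using this

/-- With `h = l = gx` in the composition axiom, the left side is `r Ω²`. On the right the term with
`(gx)² = 0` drops out, leaving `Ω (x · r) = Ω² r`. -/
lemma act_x_one_sq_comm (hact : IsPartialAction act) (hg : act (g k) 1 = 0) (r : R) :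
    act (x k) 1 * act (x k) 1 * r = r * (act (x k) 1 * act (x k) 1) := by
  have := hact.act_act (g k * x k) (g k * x k) r
  have e : g k * x k * (g k * x k) = 0 := by
    rw [← mul_assoc, gx_mul_g, neg_mul, x_mul_x, neg_zero]
  have e' : g k * (g k * x k) = x k := by rw [← mul_assoc, g_mul_g, one_mul]
  rw [comul_gx] at this
  simp only [map_add, TensorProduct.map_tmul, LinearMap.mul'_apply, LinearMap.flip_apply,
    LinearMap.comp_apply, LinearMap.mulRight_apply, e, e', act_gx hact hg, map_zero,
    mul_zero, add_zero, one_mul] at this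
  rw [act_x hact hg r] at this
  simpa [mul_assoc] using this.symm

end PartialAction

/-! ### The action of `H₄[y, σ]` on `R × R` by the swap and skew derivations. -/

section Globalization
variable {R : Type*} [Ring R] [Algebra k R]

variable (k R) in
/-- The exchange of the two factors of `R × R`. -/
def swap : Module.End k (R × R) := (LinearEquiv.prodComm k R R).toLinearMap

@[simp] lemma swap_apply (b : R × R) : swap k R b = (b.2, b.1) := rfl

variable (k) in
/-- The inner skew derivation `b ↦ (u, -u) b - b' (u, -u)`, where `b'` is `b` with its
components exchanged. -/
def skewDer (u : R) : Module.End k (R × R) :=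
  LinearMap.mulLeft k (u, -u) - LinearMap.mulRight k (u, -u) ∘ₗ swap k R

@[simp] lemma skewDer_apply (u : R) (b : R × R) :
    skewDer k u b = (u * b.1 - b.2 * u, b.1 * u - u * b.2) := by
  ext <;> simp [skewDer]; abel

lemma swap_mul_swap : swap k R * swap k R = 1 := rfl

/-- The swap negates `(u, -u)`, hence the sign. -/
lemma skewDer_mul_swap (u : R) : skewDer k u * swap k R = -(swap k R * skewDer k u) := by
  ext <;> simp

/-- With `U = (u, -u)` and `V = (v, -v)`, the mixed terms `U b' V` and `V b' U` cancel in the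
anticommutator, which becomes the commutator with `UV + VU`, both of whose components are `uv + vu`.
-/
lemma skewDer_mul_skewDer (u v : R) (h : ∀ r, (v * u + u * v) * r = r * (v * u + u * v)) :
    skewDer k u * skewDer k v = -(skewDer k v * skewDer k u) := by
  refine LinearMap.ext fun b => ?_
  have h1 := sub_eq_zero.2 (h b.1)
  have h2 := sub_eq_zero.2 (h b.2)
  simp only [Module.End.mul_apply, LinearMap.neg_apply, skewDer_apply]
  ext
  · rw [← sub_eq_zero, ← h1]; simp; noncomm_ring
  · rw [← sub_eq_zero, ← h2]; simp; noncomm_ring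

/-- The square is the commutator with `(u², u²)`. Computing it directly avoids dividing the
anticommutator by `2`. -/
lemma skewDer_mul_self (u : R) (h : ∀ r, u * u * r = r * (u * u)) :
    skewDer k u * skewDer k u = 0 := by
  refine LinearMap.ext fun b => ?_
  have h1 := sub_eq_zero.2 (h b.1)
  have h2 := sub_eq_zero.2 (h b.2)
  simp only [Module.End.mul_apply, LinearMap.zero_apply, skewDer_apply]
  ext
  · rw [Prod.fst_zero, ← h1]; noncomm_ring
  · rw [Prod.snd_zero, ← h2]; noncomm_ring

/-- The action of `H₄` on `R × R` in which `g` exchanges the factors and `x` acts by a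
skew derivation. -/
def prodRep (u : R) (hu : ∀ r, u * u * r = r * (u * u)) : Sweedler k →ₐ[k] Module.End k (R × R) :=
  lift (swap k R) (skewDer k u) swap_mul_swap (skewDer_mul_self u hu) (skewDer_mul_swap u)

/-- The action of `H₄[y, σ]` on `R × R` in which `g` exchanges the factors and `x`, `y` act by
skew derivations. -/
noncomputable def extRep (D : HopfOreData k (g k)) (u w : R) (hu : ∀ r, u * u * r = r * (u * u))
    (hw : ∀ r, (w * u + u * w) * r = r * (w * u + u * w)) :
    D.Ext →ₐ[k] Module.End k (R × R) :=
  OreExtension.lift (prodRep u hu) (skewDer k w) (by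
    have hs : skewDer k w * skewDer k u = -(skewDer k u * skewDer k w) := by
      rw [skewDer_mul_skewDer u w hw, neg_neg]
    have hg : prodRep u hu (g k) = swap k R := lift_g
    have hx : prodRep u hu (x k) = skewDer k u := lift_x
    refine fun a => LinearMap.congr_fun
      (f := LinearMap.mulLeft k (skewDer k w) ∘ₗ (prodRep u hu).toLinearMap)
      (g := LinearMap.mulRight k (skewDer k w) ∘ₗ (prodRep u hu).toLinearMap ∘ₗ D.σ.toLinearMap)
      (linearMap_ext ?_ ?_ ?_ ?_) a
    · simp
    · simp only [LinearMap.comp_apply, LinearMap.mulLeft_apply, LinearMap.mulRight_apply,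
        AlgHom.toLinearMap_apply, AlgEquiv.toLinearMap_apply, σ_g, map_neg, hg, skewDer_mul_swap]
    · simp only [LinearMap.comp_apply, LinearMap.mulLeft_apply, LinearMap.mulRight_apply,
        AlgHom.toLinearMap_apply, AlgEquiv.toLinearMap_apply, σ_x, map_neg, hx, hs]
    · simp only [LinearMap.comp_apply, LinearMap.mulLeft_apply, LinearMap.mulRight_apply,
        AlgHom.toLinearMap_apply, AlgEquiv.toLinearMap_apply, map_mul, σ_g, σ_x, hg, hx,
        neg_mul_neg]
      refine LinearMap.ext fun b =>
        (LinearMap.congr_fun (skewDer_mul_swap w) (skewDer k u b)).trans ?_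
      have hb : skewDer k w (skewDer k u b) = -skewDer k u (skewDer k w b) :=
        LinearMap.congr_fun hs b
      rw [LinearMap.neg_apply, Module.End.mul_apply, hb, map_neg, neg_neg]
      rfl)

section
variable (D : HopfOreData k (g k)) (u w : R) (hu : ∀ r, u * u * r = r * (u * u))
    (hw : ∀ r, (w * u + u * w) * r = r * (w * u + u * w))

lemma extRep_C (a : Sweedler k) : extRep D u w hu hw (OreExtension.C D.σ a) = prodRep u hu a :=
  OreExtension.lift_C a

lemma extRep_y : extRep D u w hu hw (OreExtension.y D.σ) = skewDer k w := OreExtension.lift_y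

lemma prodRep_g : prodRep u hu (g k) = swap k R := lift_g

lemma prodRep_x : prodRep u hu (x k) = skewDer k u := lift_x

/-- Compatibility with products is closed under multiplication in the bialgebra, so it need only be
checked on `g`, `x` and `y`. For the last two it is the skew Leibniz rule. -/
lemma moduleAlgebraSubalgebra_extRep : moduleAlgebraSubalgebra (extRep D u w hu hw) = ⊤ := by
  set M := moduleAlgebraSubalgebra (extRep D u w hu hw)
  have hg : OreExtension.C D.σ (g k) ∈ M := by
    intro b c
    simp [HopfOreData.comul_C, comul_g, extRep_C, prodRep_g]
  have hx : OreExtension.C D.σ (x k) ∈ M := by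
    intro b c
    simp only [HopfOreData.comul_C, comul_x, map_add, Algebra.TensorProduct.map_tmul,
      TensorProduct.map_tmul, LinearMap.mul'_apply, LinearMap.flip_apply, AlgHom.toLinearMap_apply,
      extRep_C, prodRep_g, prodRep_x, map_one, Module.End.one_apply]
    ext <;> simp <;> noncomm_ring
  have hy : OreExtension.y D.σ ∈ M := by
    intro b c
    simp only [HopfOreData.comul_y, map_add,
      TensorProduct.map_tmul, LinearMap.mul'_apply, LinearMap.flip_apply, AlgHom.toLinearMap_apply,
      extRep_C, extRep_y, prodRep_g, map_one, Module.End.one_apply]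
    ext <;> simp <;> noncomm_ring
  have hC (a : Sweedler k) : OreExtension.C D.σ a ∈ M := by
    rw [eq_sum a]
    simp only [map_add, map_smul, map_mul, map_one]
    exact M.add_mem (M.add_mem (M.add_mem (M.smul_mem M.one_mem _) (M.smul_mem hg _))
      (M.smul_mem hx _)) (M.smul_mem (M.mul_mem hg hx) _)
  refine eq_top_iff.2 fun h _ => ?_
  -- Linear extensionality on the elements `a yⁿ` is applied to the quotient map by `M`, whose
  -- vanishing means `M = ⊤`.
  have hmk : (Subalgebra.toSubmodule M).mkQ = 0 := OreExtension.linearMap_ext D.σ fun a n => by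
    simpa using M.mul_mem (hC a) (M.pow_mem hy n)
  simpa using LinearMap.congr_fun hmk h

end

end Globalization

end Sweedler

/-! ### Recursion in the power of `y` for the extension formula. -/

section Recursion
variable {k A R : Type*} [Field k] [Ring A] [HopfAlgebra k A] [Ring R] [Algebra k R]
  {g : A} (D : HopfOreData k g) (act : A →ₗ[k] R →ₗ[k] R) (w : R)

lemma qBinom_eq_zero (p : k) {n m : ℕ} (h : n < m) : qBinom p n m = 0 := by
  induction n generalizing m with
  | zero => obtain ⟨m, rfl⟩ := Nat.exists_eq_succ_of_ne_zero h.ne'; rfl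
  | succ n ih =>
    obtain ⟨m, rfl⟩ := Nat.exists_eq_succ_of_ne_zero (Nat.ne_zero_of_lt h)
    simp [qBinom, ih (show n < m by omega), ih (show n < m + 1 by omega)]

/-- The Pascal rule for the signed coefficients of the formula. Passing from `i` to `i + 1` adds `i`
to the triangular exponent, and `pⁱ` times the Pascal factor `p^(j-i)` is `pʲ`, independent of `i`;
this lets the sums be recombined. -/
lemma qBinom_coeff_succ (p : k) {j i : ℕ} (h : i ≤ j) :
    (-1) ^ (i + 1) * p ^ ((i + 1) * (i + 1 - 1) / 2) * qBinom p (j + 1) (i + 1) =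
      (-1) ^ (i + 1) * p ^ ((i + 1) * (i + 1 - 1) / 2) * qBinom p j (i + 1) -
        p ^ j * ((-1) ^ i * p ^ (i * (i - 1) / 2) * qBinom p j i) := by
  -- Writing both halves as sums `0 + 1 + ⋯` shows that the natural-number divisions are exact.
  have e : (i + 1) * (i + 1 - 1) / 2 = i * (i - 1) / 2 + i := by
    rw [← Finset.sum_range_id_mul_two, ← Finset.sum_range_id_mul_two,
      Nat.mul_div_cancel _ two_pos, Nat.mul_div_cancel _ two_pos, Finset.sum_range_succ]
  have e' : p ^ j = p ^ i * p ^ (j - i) := by rw [← pow_add, Nat.add_sub_cancel' h]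
  rw [e, e', qBinom]
  ring

namespace HopfOreData

lemma extend_C (a : A) (r : R) : D.extend act w (OreExtension.C D.σ a) r = act a r := by
  simpa [qBinom] using D.extend_apply act w 0 a r

/-- This replaces the closed formula by a one-step rule in which the only trace of the binomials is
`q^(-j)`, the scalar that appears on moving `g` past `yʲ`. -/
lemma extend_y_pow_succ_mul_C (j : ℕ) (a : A) (r : R) :
    D.extend act w (OreExtension.y D.σ ^ (j + 1) * OreExtension.C D.σ a) r =
      w * D.extend act w (OreExtension.y D.σ ^ j * OreExtension.C D.σ a) r -
        (D.χ g)⁻¹ ^ j •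
          (D.extend act w (OreExtension.y D.σ ^ j * OreExtension.C D.σ (g * a)) r * w) := by
  simp only [extend_apply]
  set p := (D.χ g)⁻¹
  rw [Finset.sum_range_succ', Finset.sum_mul, Finset.smul_sum]
  -- The term `i = 0` is split off and the rest reindexed; the range can be extended by one because
  -- `qBinom p j (j + 1) = 0`.
  have hl : w * ∑ i ∈ Finset.range (j + 1), ((-1) ^ i * p ^ (i * (i - 1) / 2) * qBinom p j i) •
        (w ^ (j - i) * act (g ^ i * a) r * w ^ i) =
      (∑ i ∈ Finset.range (j + 1),
        ((-1) ^ (i + 1) * p ^ ((i + 1) * (i + 1 - 1) / 2) * qBinom p j (i + 1)) •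
        (w ^ (j - i) * act (g ^ (i + 1) * a) r * w ^ (i + 1))) + w ^ (j + 1) * act a r := by
    rw [Finset.sum_range_succ', Finset.sum_range_succ _ j, qBinom_eq_zero p (Nat.lt_succ_self j),
      mul_add, Finset.mul_sum]
    congr 1
    · rw [mul_zero, zero_smul, add_zero]
      refine Finset.sum_congr rfl fun i hi => ?_
      have : j - i = j - (i + 1) + 1 := by have := Finset.mem_range.1 hi; omega
      rw [this, mul_smul_comm, pow_succ' w (j - (i + 1))]
      simp only [mul_assoc]
    · cases j <;> simp [qBinom, pow_succ', mul_assoc]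
  rw [hl, add_sub_right_comm, ← Finset.sum_sub_distrib]
  congr 1
  · refine Finset.sum_congr rfl fun i hi => ?_
    have hi : i ≤ j := Nat.lt_succ_iff.1 (Finset.mem_range.1 hi)
    rw [qBinom_coeff_succ p hi, sub_smul, mul_smul (p ^ j), pow_succ g i,
      pow_succ w i, smul_mul_assoc, Nat.add_sub_add_right j 1 i]
    simp only [mul_assoc]
  · simp [qBinom]

end HopfOreData
end Recursion

/-! ### Comparison with the restricted action, and necessity of centrality. -/

namespace Sweedler
variable {k R : Type*} [Field k] [Ring R] [Algebra k R] {act : Sweedler k →ₗ[k] R →ₗ[k] R}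
  (D : HopfOreData k (g k)) (w : R)

/-- The skew derivation of `w` needs the second component of `h · (r, 0)`. As `g` acts by the swap,
this is the first component of `gh · (r, 0)`. -/
lemma fstAct_y_mul (u w : R) (hu : ∀ r, u * u * r = r * (u * u))
    (hw : ∀ r, (w * u + u * w) * r = r * (w * u + u * w)) (h : D.Ext) (r : R) :
    fstAct (extRep D u w hu hw) (OreExtension.y D.σ * h) r =
      w * fstAct (extRep D u w hu hw) h r -
        fstAct (extRep D u w hu hw) (OreExtension.C D.σ (g k) * h) r * w := by
  simp [fstAct, extRep_y, extRep_C, prodRep_g]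

lemma C_g_mul_y_pow (j : ℕ) : OreExtension.C D.σ (g k) * OreExtension.y D.σ ^ j =
    (-1 : k) ^ j • (OreExtension.y D.σ ^ j * OreExtension.C D.σ (g k)) := by
  induction j with
  | zero => simp
  | succ j ih =>
    have e : OreExtension.C D.σ (g k) * OreExtension.y D.σ =
        -(OreExtension.y D.σ * OreExtension.C D.σ (g k)) := by
      rw [OreExtension.y_mul_C, σ_g, map_neg, neg_mul, neg_neg]
    rw [pow_succ, ← mul_assoc, ih, smul_mul_assoc, mul_assoc, e, pow_succ, mul_smul]
    simp [mul_assoc]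

lemma extend_eq_fstAct (hact : IsPartialAction act) (hg : act (g k) 1 = 0)
    (hw : ∀ r, (w * act (x k) 1 + act (x k) 1 * w) * r = r * (w * act (x k) 1 + act (x k) 1 * w)) :
    D.extend act w = fstAct (extRep D (act (x k) 1) w (act_x_one_sq_comm hact hg) hw) := by
  set ρ := extRep D (act (x k) 1) w (act_x_one_sq_comm hact hg) hw with hρ
  have h0 : fstAct ρ ∘ₗ (OreExtension.C D.σ).toLinearMap = act := by
    refine linearMap_ext ?_ ?_ ?_ ?_ <;> ext r
    · simp [fstAct, hact.one_act]
    · simp [fstAct, hρ, extRep_C, prodRep_g, act_g hact hg]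
    · simp [fstAct, hρ, extRep_C, prodRep_x, act_x hact hg r]
    · simp [fstAct, hρ, extRep_C, prodRep_x, prodRep_g, act_gx hact hg]
  have key (j : ℕ) (a : Sweedler k) (r : R) :
      D.extend act w (OreExtension.y D.σ ^ j * OreExtension.C D.σ a) r =
        fstAct ρ (OreExtension.y D.σ ^ j * OreExtension.C D.σ a) r := by
    induction j generalizing a with
    | zero =>
      rw [pow_zero, one_mul, D.extend_C]
      exact (LinearMap.congr_fun (LinearMap.congr_fun h0 a) r).symm
    | succ j ih =>
      -- With `χ(g) = -1`, the scalar `q^(-j)` of the recursion equals the sign `(-1)ʲ` from `g yʲ =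
      -- (-1)ʲ yʲ g`.
      rw [D.extend_y_pow_succ_mul_C, ih, ih, χ_g, pow_succ', mul_assoc, fstAct_y_mul,
        ← mul_assoc (OreExtension.C D.σ (g k)), C_g_mul_y_pow]
      simp [mul_assoc, hρ]
  refine OreExtension.linearMap_ext D.σ fun a n => LinearMap.ext fun r => ?_
  -- Bijectivity of `σⁿ` turns a left coefficient of `yⁿ` into a right one, as in the formula.
  obtain ⟨a, rfl⟩ := (D.σ ^ n).surjective a
  rw [← OreExtension.y_pow_mul_C]
  exact key n a r

lemma extend_y (hact : IsPartialAction act) (hg : act (g k) 1 = 0) (r : R) :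
    D.extend act w (OreExtension.y D.σ) r = w * r := by
  have h1 : D.extend act w 1 r = r := by
    rw [← map_one (OreExtension.C D.σ), D.extend_C, hact.one_act]
  simpa [D.extend_C, h1, act_g hact hg] using D.extend_y_pow_succ_mul_C act w 0 1 r

lemma extend_y_mul_C (a : Sweedler k) (r : R) :
    D.extend act w (OreExtension.y D.σ * OreExtension.C D.σ a) r =
      w * act a r - act (g k * a) r * w := by
  simpa [-map_mul, D.extend_C] using D.extend_y_pow_succ_mul_C act w 0 a r

lemma mul_add_mul_comm_of_isPartialAction_extend (hact : IsPartialAction act)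
    (hg : act (g k) 1 = 0) (h : IsPartialAction (D.extend act w)) (r : R) :
    (w * act (x k) 1 + act (x k) 1 * w) * r = r * (w * act (x k) 1 + act (x k) 1 * w) := by
  have hy := extend_y_mul_C (act := act) D w (g k)
  simp only [act_g hact hg, g_mul_g, hact.one_act, mul_zero, zero_sub] at hy
  have e1 : OreExtension.C D.σ (g k) * (OreExtension.y D.σ * OreExtension.C D.σ (g k)) =
      -OreExtension.y D.σ := by
    rw [OreExtension.y_mul_C, σ_g, ← mul_assoc, ← map_mul, mul_neg, g_mul_g]
    simp
  have e2 : OreExtension.C D.σ (g k * x k) * (OreExtension.y D.σ * OreExtension.C D.σ (g k)) =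
      -(OreExtension.y D.σ * OreExtension.C D.σ (x k)) := by
    rw [OreExtension.y_mul_C, OreExtension.y_mul_C, σ_g, σ_x, ← mul_assoc, ← map_mul, mul_neg,
      gx_mul_g]
    simp
  -- The pair `gx`, `yg` is chosen since `yg · r = -r w`. The left side is then `-r w Ω`, and the
  -- right side is `-Ω (y · r) - (yx) · r = -Ω w r - w Ω r + r Ω w`.
  have := h.act_act (OreExtension.C D.σ (g k * x k))
    (OreExtension.y D.σ * OreExtension.C D.σ (g k)) r
  rw [HopfOreData.comul_C, comul_gx] at this
  simp only [map_add, Algebra.TensorProduct.map_tmul, TensorProduct.map_tmul, LinearMap.mul'_apply,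
    LinearMap.flip_apply, LinearMap.comp_apply, LinearMap.mulRight_apply, e1, e2, hy, map_neg,
    extend_y_mul_C, D.extend_C, act_gx hact hg, one_mul, hact.one_act,
    extend_y D w hact hg] at this
  rw [act_x hact hg r] at this
  rw [← sub_eq_zero] at this ⊢
  rw [← this]
  noncomm_ring

end Sweedler

theorem mainTheorem8 {k R : Type*} [Field k] [IsAlgClosed k] [CharZero k] [Ring R] [Algebra k R]
    (act : Sweedler k →ₗ[k] R →ₗ[k] R) (hact : IsPartialAction act)
    (hg : act (Sweedler.g k) 1 = 0)
    (D : HopfOreData k (Sweedler.g k)) (w : R) :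
    D.extend act w (OreExtension.y D.σ) 1 = w ∧
      (IsSymmetricPartialAction (D.extend act w) ↔
        w * act (Sweedler.x k) 1 + act (Sweedler.x k) 1 * w ∈ Subalgebra.center k R) := by
  refine ⟨by rw [Sweedler.extend_y D w hact hg, mul_one], fun h => ?_, fun h => ?_⟩
  · rw [Subalgebra.mem_center_iff]
    exact fun r =>
      (Sweedler.mul_add_mul_comm_of_isPartialAction_extend D w hact hg h.toIsPartialAction r).symm
  · rw [Subalgebra.mem_center_iff] at h
    rw [Sweedler.extend_eq_fstAct D w hact hg fun r => (h r).symm]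
    exact isSymmetricPartialAction_fstAct _ (Sweedler.moduleAlgebraSubalgebra_extRep ..)
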